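/- Let $R$ be a finite commutative ring with identity, and let $Z(R)^{*}$ be the set of nonzero zero-divisors of $R$. The weakly zero-divisor graph $W\Gamma(R)$ has vertex set $Z(R)^{*}$, and two distinct vertices $x,y$ are adjacent if and only if there are nonzero $r,s\in R$ with $rx=0$, $sy=0$ and $rs=0$. Let $R\cong\prod_{i=1}^{n}R_i$ be a decomposition of $R$ into a product of local rings, and write $x=(x_1,\dots,x_n)$ for the image of $x\in R$. Put $F=\{i : R_i\text{ is a field}\}$; for $k\in F$ let $$V_k=\{x\in Z(R)^{*} : x_k=0\text{ and }x_i\text{ is a unit of }R_i\text{ for all }i\neq k\},$$ and let $V_0=Z(R)^{*}\setminus\bigcup_{k\in F}V_k$. Write $N=|Z(R)^{*}|$, and let $\tau(W\Gamma(R))$ be the number of spanning trees of $W\Gamma(R)$. If $N=1$, then $W\Gamma(R)$ is a single vertex and $\tau(W\Gamma(R))=1$. If $N\ge 2$, then $$\tau(W\Gamma(R))=N^{\,|F|+|V_0|-2}\prod_{k\in F}\bigl(N-|V_k|\bigr)^{|V_k|-1},$$ where the empty product over $F=\varnothing$ is $1$. -/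

import Mathlib

universe u

/-- The number `τ(G)` of spanning trees of a simple graph `G`: the number of trees on the full
vertex set of `G` all of whose edges are edges of `G`. -/
noncomputable def SimpleGraph.spanningTreeCount {V : Type*} (G : SimpleGraph V) : ℕ :=
  Set.ncard {T : SimpleGraph V | T ≤ G ∧ T.IsTree}

/-- `Z(R)^*`: the set of nonzero zero-divisors of a commutative ring `R`. -/
def nonzeroZeroDivisors (R : Type*) [CommRing R] : Set R :=
  {x | x ≠ 0 ∧ ∃ y : R, y ≠ 0 ∧ x * y = 0}

/-- The weakly zero-divisor graph `WΓ(R)`: its vertices are the nonzero zero-divisors of `R`, and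
two distinct vertices `x`, `y` are adjacent when there are nonzero `r ∈ Ann(x)` and
`s ∈ Ann(y)` with `r * s = 0`. -/
def weaklyZeroDivisorGraph (R : Type*) [CommRing R] : SimpleGraph (nonzeroZeroDivisors R) where
  Adj x y := x ≠ y ∧ ∃ r s : R, r ≠ 0 ∧ s ≠ 0 ∧ r * x = 0 ∧ s * y = 0 ∧ r * s = 0
  symm := ⟨by
    rintro x y ⟨hxy, r, s, hr, hs, hrx, hsy, hrs⟩
    exact ⟨hxy.symm, s, r, hs, hr, hsy, hrx, by rw [mul_comm, hrs]⟩⟩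
  loopless := ⟨fun _ h => h.1 rfl⟩

/-- A decomposition `R ≃ ∏ i, A i` of a commutative ring `R` into a finite product of
local rings. -/
structure LocalDecomposition (R : Type*) [CommRing R] (ι : Type*) [Fintype ι]
    (A : ι → Type*) [∀ i, CommRing (A i)] where
  isLocalRing : ∀ i, IsLocalRing (A i)
  equiv : R ≃+* ((i : ι) → A i)

namespace LocalDecomposition

/-- Every finite commutative ring has a decomposition into a finite product of local rings. -/
theorem exists_of_finite (R : Type u) [CommRing R] [Finite R] :
    ∃ (n : ℕ) (A : Fin n → Type u) (_ : ∀ i, CommRing (A i)),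
      Nonempty (LocalDecomposition R (Fin n) A) := by
  obtain ⟨n, f⟩ := Finite.exists_equiv_fin (PrimeSpectrum R)
  refine ⟨n, fun i => Localization.AtPrime (f.some.symm i).asIdeal,
    fun i => inferInstance, ⟨?_, ?_⟩⟩
  · intro i
    exact (inferInstance : IsLocalRing (Localization.AtPrime (f.some.symm i).asIdeal))
  · exact (PrimeSpectrum.toPiLocalizationEquiv R).toRingEquiv.trans
      (RingEquiv.piCongrLeft' (fun p : PrimeSpectrum R => Localization.AtPrime p.asIdeal) f.some)

variable {R : Type*} [CommRing R] {ι : Type*} [Fintype ι] {A : ι → Type*} [∀ i, CommRing (A i)]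

open scoped Classical in
/-- The set `F` of the indices `i` for which the local factor `A i` is a field. -/
noncomputable def fieldIndices (_D : LocalDecomposition R ι A) : Finset ι :=
  Finset.univ.filter fun i => IsField (A i)

/-- `V_k`: the nonzero zero-divisors of `R` whose `k`-th coordinate is `0` and all of whose other
coordinates are units. -/
def part (D : LocalDecomposition R ι A) (k : ι) : Set R :=
  {x | x ∈ nonzeroZeroDivisors R ∧ D.equiv x k = 0 ∧ ∀ i, i ≠ k → IsUnit (D.equiv x i)}

/-- `V_0`: the nonzero zero-divisors of `R` that lie in none of the sets `V_k`, `k ∈ F`. -/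
def rest (D : LocalDecomposition R ι A) : Set R :=
  nonzeroZeroDivisors R \ ⋃ k ∈ D.fieldIndices, D.part k

end LocalDecomposition

/-!
The graph is complete multipartite, and its spanning trees are counted with the matrix-tree theorem.

*The graph.* A finite local ring has a nonzero element `r` that annihilates all nonunits, and
`r * r = 0` unless the ring is a field (`IsLocalRing.exists_ne_zero_forall_mul_eq_zero`). If two
vertices `x`, `y` have nonunit coordinates at different places, or at a common place where the
factor is not a field, then these elements, supported at one coordinate each, show that `x` and `y`
are adjacent. What is left is the case of two elements of the same `V_k`; there both annihilators
are the field factor `k`, which has no zero-divisors. So the classes of the multipartite graph are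
the sets `V_k` with `k ∈ F`, together with one singleton for each element of `V_0`
(`LocalDecomposition.weaklyZeroDivisorGraph_adj_iff_vertexClass_ne`).

*The matrix-tree theorem.* Fix a root `r`. A spanning tree is the same thing as its parent map,
which sends each vertex to its neighbour in the direction of `r`
(`SimpleGraph.spanningTreeCount_eq_ncard_parentMap`). Row `v` of the Laplacian `L` is the sum of
`e_v - e_w` over the neighbours `w` of `v`, so multilinear expansion writes the determinant of the
reduced Laplacian as a sum over all maps `f` that send each vertex to a neighbour; the term of `f`
is `1` if iterating `f` leads every vertex to `r`, since the matrix is then unitriangular, and `0`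
otherwise, since the indicator vector of the vertices that never reach `r` lies in the kernel.
Row and column operations give the equivalent form `det (L + J) = |V| ^ 2 * τ`, with `J` the
all-ones matrix (`card_sq_mul_spanningTreeCount`).

*The determinant.* For a complete multipartite graph, `L + J` is the diagonal degree matrix plus
`C * Cᵀ`, where `C` is the incidence matrix of vertices and classes, and the matrix determinant
lemma evaluates it (`card_sq_mul_spanningTreeCount_of_adj_iff`). The classes that are singletons
contribute a factor `|V|` each, and nothing else.
-/

section Graphs

open Finset Matrix

/-! ### Parent maps of rooted trees -/

/-- `f` is the parent map of a tree rooted at `r`: iterating `f` leads every vertex to `r`. By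
convention the root is its own parent. -/
def IsParentMap {V : Type*} (r : V) (f : V → V) : Prop :=
  f r = r ∧ ∀ v, ∃ n, f^[n] v = r

/-- The graph joining each vertex to its image under `f`; the loops at fixed points are dropped. -/
def parentGraph {V : Type*} (f : V → V) : SimpleGraph V :=
  SimpleGraph.fromRel fun u v => f u = v

namespace IsParentMap

variable {V : Type*} {r : V} {f g : V → V}

theorem eq_root_of_iterate (hf : IsParentMap r f) {v : V} {k : ℕ} (hk : f^[k + 1] v = v) :
    v = r := by
  obtain ⟨n, hn⟩ := hf.2 v
  have h1 : f^[(k + 1) * n] v = v := by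
    rw [Function.iterate_mul]
    exact Function.iterate_fixed hk n
  have h2 : f^[k * n + n] v = r := by
    rw [Function.iterate_add_apply, hn]
    exact Function.iterate_fixed hf.1 _
  rw [← h1, ← h2]
  congr 2
  ring

theorem apply_ne (hf : IsParentMap r f) {v : V} (hv : v ≠ r) : f v ≠ v :=
  fun h => hv (hf.eq_root_of_iterate (k := 0) h)

theorem apply_apply_ne (hf : IsParentMap r f) {v : V} (hv : v ≠ r) : f (f v) ≠ v :=
  fun h => hv (hf.eq_root_of_iterate (k := 1) h)

theorem adj_apply (hf : IsParentMap r f) {v : V} (hv : v ≠ r) : (parentGraph f).Adj v (f v) := by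
  rw [parentGraph, SimpleGraph.fromRel_adj]
  exact ⟨(hf.apply_ne hv).symm, Or.inl rfl⟩

theorem connected (hf : IsParentMap r f) : (parentGraph f).Connected := by
  have key : ∀ n v, f^[n] v = r → (parentGraph f).Reachable v r := by
    intro n
    induction n with
    | zero => rintro v rfl; exact SimpleGraph.Reachable.rfl
    | succ n ih =>
      intro v hv
      by_cases h : v = r
      · rw [h]
      · exact (hf.adj_apply h).reachable.trans (ih (f v) hv)
  rw [SimpleGraph.connected_iff_exists_forall_reachable]
  refine ⟨r, fun v => ?_⟩
  obtain ⟨n, hn⟩ := hf.2 v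
  exact (key n v hn).symm

/-- The parent graph is a tree: it is connected, and it has at most one edge for each vertex other
than the root. -/
theorem isTree [Finite V] (hf : IsParentMap r f) : (parentGraph f).IsTree := by
  classical
  have := Fintype.ofFinite V
  rw [SimpleGraph.isTree_iff_connected_and_card]
  refine ⟨hf.connected, le_antisymm ?_ hf.connected.card_vert_le_card_edgeSet_add_one⟩
  have hsub : (parentGraph f).edgeSet ⊆ ((univ.erase r).image fun v => s(v, f v) : Finset _) := by
    intro e
    induction e with
    | _ u v =>
      rw [SimpleGraph.mem_edgeSet, parentGraph, SimpleGraph.fromRel_adj]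
      rintro ⟨huv, rfl | rfl⟩
      · have : u ≠ r := by rintro rfl; exact huv hf.1.symm
        simp only [coe_image, Set.mem_image]
        exact ⟨u, by simpa using this, rfl⟩
      · have : v ≠ r := by rintro rfl; exact huv hf.1
        simp only [coe_image, Set.mem_image]
        exact ⟨v, by simpa using this, Sym2.eq_swap⟩
  have h1 : Nat.card (parentGraph f).edgeSet ≤ #(univ.erase r) := by
    rw [Nat.card_coe_set_eq]
    exact (Set.ncard_le_ncard hsub (Finset.finite_toSet _)).trans
      (by rw [Set.ncard_coe_finset]; exact card_image_le)
  rw [Nat.card_eq_fintype_card (α := V), ← Finset.card_univ, ← card_erase_add_one (mem_univ r)]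
  exact Nat.add_le_add_right h1 1

theorem apply_eq_or_of_le (hf : IsParentMap r f) (hfg : parentGraph f ≤ parentGraph g)
    {v : V} (hv : v ≠ r) : g v = f v ∨ g (f v) = v := by
  have := hfg (hf.adj_apply hv)
  rw [parentGraph, SimpleGraph.fromRel_adj] at this
  exact this.2

/-- A parent map is determined by its tree and its root. -/
theorem eq_of_parentGraph_eq (hf : IsParentMap r f) (hg : IsParentMap r g)
    (h : parentGraph f = parentGraph g) : f = g := by
  have key : ∀ n v, f^[n] v = r → f v = g v := by
    intro n
    induction n with
    | zero => rintro v rfl; exact hf.1.trans hg.1.symm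
    | succ n ih =>
      intro v hv
      by_cases hr : v = r
      · rw [hr, hf.1, hg.1]
      rcases hf.apply_eq_or_of_le h.le hr with h1 | h1
      · exact h1.symm
      -- If the edge from `v` to `f v` were directed the other way in `g`, the maps would
      -- already agree at `f v`, and `f` would have a 2-cycle.
      · exact absurd ((ih (f v) hv).trans h1) (hf.apply_apply_ne hr)
  funext v
  obtain ⟨n, hn⟩ := hf.2 v
  exact key n v hn

/-- Every tree has a parent map: send each vertex to a neighbour that is nearer to the root. -/
theorem exists_of_isTree [Finite V] {T : SimpleGraph V} (hT : T.IsTree) (r : V) :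
    ∃ f, IsParentMap r f ∧ (∀ v, v ≠ r → T.Adj v (f v)) ∧ parentGraph f = T := by
  classical
  have step : ∀ v, v ≠ r → ∃ w, T.Adj v w ∧ T.dist w r < T.dist v r := by
    intro v hv
    obtain ⟨p, hp⟩ := hT.connected.exists_walk_length_eq_dist v r
    cases p with
    | nil => exact absurd rfl hv
    | cons hadj q =>
      refine ⟨_, hadj, ?_⟩
      rw [← hp, SimpleGraph.Walk.length_cons]
      exact Nat.lt_succ_of_le (SimpleGraph.dist_le q)
  choose! f hadj hlt using step
  let f' : V → V := fun v => if v = r then r else f v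
  have hr : f' r = r := if_pos rfl
  have hne : ∀ v, v ≠ r → f' v = f v := fun v hv => if_neg hv
  have hf : IsParentMap r f' := by
    refine ⟨hr, fun v => ?_⟩
    induction hd : T.dist v r using Nat.strong_induction_on generalizing v with
    | _ d ih =>
      by_cases hv : v = r
      · exact ⟨0, hv⟩
      · obtain ⟨n, hn⟩ := ih _ (hd ▸ hlt v hv) (f v) rfl
        exact ⟨n + 1, by rw [Function.iterate_succ_apply, hne v hv, hn]⟩
  have hadj' : ∀ v, v ≠ r → T.Adj v (f' v) := fun v hv => by
    rw [hne v hv]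
    exact hadj v hv
  have hle : parentGraph f' ≤ T := by
    intro u v huv
    rw [parentGraph, SimpleGraph.fromRel_adj] at huv
    obtain ⟨huv, rfl | rfl⟩ := huv
    · exact hadj' u (by rintro rfl; exact huv hr.symm)
    · exact (hadj' v (by rintro rfl; exact huv hr)).symm
  exact ⟨f', hf, hadj', le_antisymm hle
    ((SimpleGraph.isTree_iff_minimal_connected.mp hT).2 hf.connected hle)⟩

end IsParentMap

theorem SimpleGraph.spanningTreeCount_eq_ncard_parentMap {V : Type*} [Finite V]
    (G : SimpleGraph V) (r : V) :
    G.spanningTreeCount = {f : V → V | IsParentMap r f ∧ ∀ v, v ≠ r → G.Adj v (f v)}.ncard := by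
  refine (Set.ncard_congr (fun f _ => parentGraph f) ?_ ?_ ?_).symm
  · rintro f ⟨hf, hG⟩
    refine ⟨fun u v huv => ?_, hf.isTree⟩
    rw [parentGraph, SimpleGraph.fromRel_adj] at huv
    obtain ⟨huv, rfl | rfl⟩ := huv
    · exact hG u (by rintro rfl; exact huv hf.1.symm)
    · exact (hG v (by rintro rfl; exact huv hf.1)).symm
  · rintro f g ⟨hf, -⟩ ⟨hg, -⟩ h
    exact hf.eq_of_parentGraph_eq hg h
  · rintro T ⟨hTG, hT⟩
    obtain ⟨f, hf, hadj, rfl⟩ := IsParentMap.exists_of_isTree hT r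
    exact ⟨f, ⟨hf, fun v hv => hTG (hadj v hv)⟩, rfl⟩

/-! ### The matrix-tree theorem -/

section MatrixTree

variable {V : Type*} [Fintype V] [DecidableEq V]

/-- The matrix `1 - P`, where row `v` of `P` is the unit row vector at `f v`, with its row at `r`
replaced by the unit row vector at `r`. -/
def functionLaplacian (R : Type*) [CommRing R] (r : V) (f : V → V) : Matrix V V R :=
  Matrix.of fun v => if v = r then Pi.single r 1 else Pi.single v 1 - Pi.single (f v) 1

/-- For a parent map the matrix is unitriangular when vertices are ordered by their depth: a
permutation that contributes to the determinant does not increase depth anywhere, so it preserves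
depth and is the identity. -/
theorem IsParentMap.det_functionLaplacian (R : Type*) [CommRing R] {r : V} {f : V → V}
    (hf : IsParentMap r f) : (functionLaplacian R r f).det = 1 := by
  classical
  let d : V → ℕ := fun v => Nat.find (hf.2 v)
  have hd : ∀ v, v ≠ r → d (f v) < d v := by
    intro v hv
    have h1 : f^[d v] v = r := Nat.find_spec (hf.2 v)
    obtain ⟨k, hk⟩ : ∃ k, d v = k + 1 := by
      refine Nat.exists_eq_succ_of_ne_zero fun h => hv ?_
      rwa [h] at h1
    rw [hk] at h1 ⊢
    exact Nat.lt_succ_of_le (Nat.find_min' (hf.2 (f v)) h1)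
  have hdiag : ∀ v, functionLaplacian R r f v v = 1 := by
    intro v
    by_cases hv : v = r
    · simp [functionLaplacian, hv]
    · simp [functionLaplacian, hv, (hf.apply_ne hv).symm]
  have hzero : ∀ v w, v ≠ w → d v ≤ d w → functionLaplacian R r f v w = 0 := by
    intro v w hvw hle
    by_cases hv : v = r
    · subst hv
      simp [functionLaplacian, hvw.symm]
    · have : w ≠ f v := by
        rintro rfl
        exact absurd (hd v hv) (not_lt.mpr hle)
      simp [functionLaplacian, hv, hvw.symm, this]
  rw [← det_transpose, det_apply, sum_eq_single (1 : Equiv.Perm V)]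
  · simp [hdiag]
  · intro σ _ hσ
    by_contra hne
    have hle : ∀ v ∈ univ, d (σ v) ≤ d v := by
      intro v _
      by_cases h : v = σ v
      · rw [← h]
      · by_contra hlt
        refine hne ?_
        rw [prod_eq_zero (mem_univ v), smul_zero]
        exact hzero v (σ v) h (not_le.mp hlt).le
    have heq := (sum_eq_sum_iff_of_le hle).mp (Equiv.sum_comp σ d)
    refine hσ (Equiv.ext fun v => ?_)
    by_contra h
    refine hne ?_
    rw [prod_eq_zero (mem_univ v), smul_zero]
    exact hzero v (σ v) (Ne.symm h) (heq v (mem_univ v)).ge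
  · simp

/-- If some vertex never reaches `r`, the indicator vector of the set of such vertices lies in the
kernel. -/
theorem det_functionLaplacian_eq_zero {R : Type*} [CommRing R] [IsDomain R] {r : V} {f : V → V}
    (hf : ∃ v, ∀ n, f^[n] v ≠ r) : (functionLaplacian R r f).det = 0 := by
  classical
  obtain ⟨v₀, hv₀⟩ := hf
  let χ : V → R := fun v => if ∀ n, f^[n] v ≠ r then 1 else 0
  have hχr : χ r = 0 := if_neg fun h => h 0 rfl
  have hχ : ∀ v, v ≠ r → χ (f v) = χ v := by
    intro v hv
    have : (∀ n, f^[n] (f v) ≠ r) ↔ ∀ n, f^[n] v ≠ r := by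
      refine ⟨fun h n => ?_, fun h n => h (n + 1)⟩
      cases n with
      | zero => exact hv
      | succ n => exact h n
    simp only [χ, this]
  refine exists_mulVec_eq_zero_iff.mp ⟨χ, fun h => ?_, ?_⟩
  · have : χ v₀ = 1 := if_pos hv₀
    rw [h] at this
    exact zero_ne_one this
  · funext v
    by_cases hv : v = r
    · simp [functionLaplacian, mulVec, hv, hχr]
    · have hrow : functionLaplacian R r f v = Pi.single v 1 - Pi.single (f v) 1 := by
        exact if_neg hv
      change functionLaplacian R r f v ⬝ᵥ χ = 0
      rw [hrow, sub_dotProduct, single_one_dotProduct, single_one_dotProduct, hχ v hv, sub_self]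

variable (R : Type*) [CommRing R] (G : SimpleGraph V) [DecidableRel G.Adj]

/-- The Laplacian of `G` with its row at `r` replaced by the unit row vector at `r`. -/
def rootedLaplacian (r : V) : Matrix V V R :=
  (G.lapMatrix R).updateRow r (Pi.single r 1)

theorem lapMatrix_row (v : V) :
    G.lapMatrix R v =
      ∑ w, (if G.Adj v w then (1 : R) else 0) • (Pi.single v 1 - Pi.single w 1) := by
  funext u
  have h : G.lapMatrix R v u =
      (if v = u then (G.degree v : R) else 0) - if G.Adj v u then 1 else 0 := by
    rw [SimpleGraph.lapMatrix, Matrix.sub_apply, SimpleGraph.degMatrix, diagonal_apply,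
      SimpleGraph.adjMatrix_apply]
  rw [h]
  simp only [Finset.sum_apply, Pi.smul_apply, Pi.sub_apply, smul_eq_mul, mul_sub,
    sum_sub_distrib, Pi.single_apply]
  congr 1
  · rw [← sum_mul, sum_boole, ← SimpleGraph.card_neighborFinset_eq_degree,
      SimpleGraph.neighborFinset_eq_filter]
    by_cases h : v = u
    · simp [h]
    · simp [h, Ne.symm h]
  · simp

/-- Expanding every row of the reduced Laplacian as a sum over the neighbours of its vertex turns
the determinant into a sum over maps `f`, of which exactly the parent maps survive. -/
theorem spanningTreeCount_eq_det_rootedLaplacian [IsDomain R] (r : V) :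
    (G.spanningTreeCount : R) = (rootedLaplacian R G r).det := by
  classical
  have hrow : rootedLaplacian R G r = fun v => ∑ w,
      (if v = r then (if w = r then (1 : R) else 0) else if G.Adj v w then 1 else 0) •
        (if v = r then Pi.single r 1 else Pi.single v 1 - Pi.single w 1 : V → R) := by
    funext v
    by_cases hv : v = r
    · subst hv
      simp [rootedLaplacian]
    · simp only [rootedLaplacian, hv, if_false]
      rw [updateRow_ne hv, lapMatrix_row]
  have hdet : (rootedLaplacian R G r).det = ∑ f : V → V,
      (∏ v, if v = r then (if f v = r then (1 : R) else 0) else if G.Adj v (f v) then 1 else 0) *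
        (functionLaplacian R r f).det := by
    rw [hrow]
    refine ((detRowAlternating (R := R) (n := V)).toMultilinearMap.map_sum _).trans ?_
    refine sum_congr rfl fun f _ => ?_
    rw [MultilinearMap.map_smul_univ]
    rfl
  rw [hdet, G.spanningTreeCount_eq_ncard_parentMap r, Set.ncard_eq_toFinset_card',
    Set.toFinset_ofPred, ← sum_boole]
  refine sum_congr rfl fun f _ => ?_
  have hprod : (∏ v, if v = r then (if f v = r then (1 : R) else 0)
      else if G.Adj v (f v) then 1 else 0) =
      if f r = r ∧ ∀ v, v ≠ r → G.Adj v (f v) then 1 else 0 := by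
    have : ∀ v, (if v = r then (if f v = r then (1 : R) else 0)
        else if G.Adj v (f v) then 1 else 0) =
        if (v = r → f r = r) ∧ (v ≠ r → G.Adj v (f v)) then 1 else 0 := by
      intro v
      by_cases hv : v = r
      · subst hv
        simp
      · simp [hv]
    rw [prod_congr rfl fun v _ => this v, prod_boole]
    congr 1
    simp [forall_and]
  rw [hprod]
  by_cases hreach : ∀ v, ∃ n, f^[n] v = r
  · by_cases hr : f r = r
    · have hf : IsParentMap r f := ⟨hr, hreach⟩
      simp [hf, hr, hf.det_functionLaplacian R]
    · simp [hr, IsParentMap]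
  · rw [det_functionLaplacian_eq_zero (by simpa using hreach), mul_zero,
      if_neg fun h => hreach h.1.2]

/-- Adding the all-ones matrix to the Laplacian multiplies the reduced determinant by `|V| ^ 2`:
adding all rows to row `r` produces a factor `|V|`, after which the all-ones summand can be cleared
from the other rows, and adding all columns to column `r` produces the second factor. -/
theorem det_lapMatrix_add_ones (r : V) :
    (G.lapMatrix R + Matrix.of fun _ _ => 1).det =
      (Fintype.card V : R) ^ 2 * (rootedLaplacian R G r).det := by
  set L := G.lapMatrix R
  set n : R := (Fintype.card V : R) with hn
  have hrowsum : ∀ i, ∑ j, L i j = 0 := by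
    intro i
    have := congrFun (G.lapMatrix_mulVec_const_eq_zero (R := R)) i
    simpa [mulVec, dotProduct] using this
  have hcolsum : ∀ j, ∑ i, L i j = 0 := by
    intro j
    rw [← hrowsum j]
    exact sum_congr rfl fun i _ => (G.isSymm_lapMatrix (R := R)).apply j i
  have h1 : (L + Matrix.of fun _ _ => 1).det = n * (L.updateRow r fun _ => 1).det := by
    have e1 := det_updateRow_sum (L + Matrix.of fun _ _ => 1) r fun _ => 1
    have e2 : ∑ k, (1 : R) • (L + Matrix.of fun _ _ => 1 : Matrix V V R) k = n • fun _ => 1 := by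
      funext j
      have : ∀ k, (1 : R) • (L + Matrix.of fun _ _ => 1 : Matrix V V R) k = fun j => L k j + 1 :=
        fun k => one_smul _ _
      simp only [this, Finset.sum_apply, sum_add_distrib, hcolsum]
      simp [hn]
    rw [one_smul, e2, det_updateRow_smul] at e1
    rw [← e1]
    congr 1
    refine det_eq_of_forall_row_eq_smul_add_const (fun i => if i = r then 0 else 1) r (by simp) ?_
    intro i j
    by_cases hi : i = r
    · subst hi
      simp
    · simp [hi]
  have h2 : ∀ w : V → R, (L.updateRow r w).det =
      (∑ j, w j) * ((L.updateRow r w).updateCol r (Pi.single r 1)).det := by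
    intro w
    have e1 := det_updateCol_sum (L.updateRow r w) r fun _ => 1
    have e2 : (fun k => ∑ i, (1 : R) • L.updateRow r w k i) = (∑ j, w j) • Pi.single r 1 := by
      funext k
      by_cases hk : k = r
      · subst hk
        simp
      · simp [hk, hrowsum]
    rw [one_smul, e2, det_updateCol_smul] at e1
    exact e1.symm
  have h3 : ((L.updateRow r fun _ => 1).updateCol r (Pi.single r 1)).det =
      ((L.updateRow r (Pi.single r 1)).updateCol r (Pi.single r 1)).det := by
    rw [← det_transpose, ← det_transpose (updateCol _ _ _)]
    refine det_eq_of_forall_row_eq_smul_add_const (fun j => if j = r then 0 else 1) r (by simp) ?_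
    intro j i
    simp only [transpose_apply]
    by_cases hj : j = r
    · subst hj
      simp
    · by_cases hi : i = r
      · subst hi
        simp [hj]
      · simp [updateCol_ne hj, hi]
  rw [h1, h2, h3, rootedLaplacian, h2 (Pi.single r 1)]
  simp [hn, sq, mul_assoc]

/-- The matrix-tree theorem, in the form that uses the all-ones matrix instead of a minor. -/
theorem card_sq_mul_spanningTreeCount [IsDomain R] [Nonempty V] :
    (Fintype.card V : R) ^ 2 * G.spanningTreeCount =
      (G.lapMatrix R + Matrix.of fun _ _ => 1).det := by
  obtain ⟨r⟩ := ‹Nonempty V›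
  rw [det_lapMatrix_add_ones R G r, spanningTreeCount_eq_det_rootedLaplacian]

end MatrixTree

/-! ### Complete multipartite graphs -/

/-- The number of spanning trees of a complete multipartite graph, given by the map `c` to the set
of its classes; every class is nonempty and none is the whole vertex set. Adding the all-ones matrix
to the Laplacian leaves the diagonal matrix of degrees plus the matrix `C * Cᵀ` with `C` the
incidence matrix of vertices and classes, and the determinant lemma reduces the computation to a
diagonal matrix indexed by the classes. -/
theorem card_sq_mul_spanningTreeCount_of_adj_iff {V K : Type*} [Fintype V] [Nonempty V] [Fintype K]
    [DecidableEq K] (G : SimpleGraph V) (c : V → K) (hc : Function.Surjective c)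
    (hG : ∀ x y, G.Adj x y ↔ c x ≠ c y) (hK : ∀ k, #{x | c x = k} ≠ Fintype.card V) :
    (Fintype.card V : ℚ) ^ 2 * G.spanningTreeCount = (Fintype.card V : ℚ) ^ Fintype.card K *
      ∏ k, ((Fintype.card V : ℚ) - #{x | c x = k}) ^ (#{x | c x = k} - 1) := by
  classical
  set n : ℚ := (Fintype.card V : ℚ) with hn
  let m : K → ℕ := fun k => #{x | c x = k}
  have hm : ∀ k, n - m k ≠ 0 := fun k h => hK k (by
    have : (m k : ℚ) = Fintype.card V := (sub_eq_zero.mp h).symm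
    exact_mod_cast this)
  let C : Matrix V K ℚ := Matrix.of fun x k => if c x = k then 1 else 0
  let d : V → ℚ := fun x => n - m (c x)
  have hdeg : ∀ x, (G.degree x : ℚ) = d x := by
    intro x
    have h1 : G.neighborFinset x = univ \ ({y | c y = c x} : Finset V) := by
      ext y
      simp [hG, eq_comm]
    rw [← SimpleGraph.card_neighborFinset_eq_degree, h1, cast_card_sdiff (subset_univ _),
      card_univ]
  have hL : G.lapMatrix ℚ + Matrix.of (fun _ _ => 1) = diagonal d + C * Cᵀ := by
    ext x y
    have h1 : (C * Cᵀ) x y = if c x = c y then 1 else 0 := by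
      simp [C, mul_apply, eq_comm]
    rw [Matrix.add_apply, Matrix.add_apply, h1, SimpleGraph.lapMatrix, Matrix.sub_apply,
      SimpleGraph.degMatrix, diagonal_apply, diagonal_apply, SimpleGraph.adjMatrix_apply, hdeg, hG]
    by_cases h : c x = c y <;> simp [h]
  have hdet : (diagonal d).det = ∏ k, (n - m k) ^ m k := by
    rw [det_diagonal, ← prod_fiberwise univ c]
    refine prod_congr rfl fun k _ => ?_
    rw [prod_congr rfl (g := fun _ => n - m k) fun x hx => by
      simp only [mem_filter] at hx
      simp only [d, hx.2], prod_const]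
  have hunit : IsUnit (diagonal d).det := by
    rw [hdet, isUnit_iff_ne_zero]
    exact prod_ne_zero_iff.mpr fun k _ => pow_ne_zero _ (hm k)
  have hinv : (diagonal d)⁻¹ = diagonal fun x => (d x)⁻¹ := by
    refine inv_eq_left_inv ?_
    rw [diagonal_mul_diagonal, ← diagonal_one]
    congr 1
    funext x
    exact inv_mul_cancel₀ (hm _)
  have hsmall : 1 + Cᵀ * (diagonal d)⁻¹ * C = diagonal fun k => n / (n - m k) := by
    ext k l
    have h1 : (Cᵀ * diagonal (fun x => (d x)⁻¹) * C) k l =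
        if k = l then (m k : ℚ) * (n - m k)⁻¹ else 0 := by
      rw [mul_apply]
      simp only [mul_diagonal, transpose_apply, C, of_apply, d]
      by_cases hkl : k = l
      · subst hkl
        rw [if_pos rfl, ← nsmul_eq_mul, ← sum_const, sum_filter]
        refine sum_congr rfl fun x _ => ?_
        by_cases h : c x = k <;> simp [h]
      · rw [if_neg hkl]
        refine sum_eq_zero fun x _ => ?_
        by_cases h : c x = k <;> simp [h, hkl]
    rw [hinv, Matrix.add_apply, h1, one_apply, diagonal_apply]
    by_cases hkl : k = l
    · simp only [hkl, if_true]
      field_simp [hm l]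
      ring
    · simp [hkl]
  rw [card_sq_mul_spanningTreeCount, hL, det_add_mul _ _ hunit, hsmall, hdet, det_diagonal,
    ← prod_mul_distrib, ← card_univ, ← prod_const, ← prod_mul_distrib]
  refine prod_congr rfl fun k _ => ?_
  have hpos : 0 < m k := by
    obtain ⟨x, hx⟩ := hc k
    exact card_pos.mpr ⟨x, by simp [hx]⟩
  obtain ⟨j, hj⟩ := Nat.exists_eq_succ_of_ne_zero hpos.ne'
  change (n - m k) ^ m k * (n / (n - m k)) = n * (n - m k) ^ (m k - 1)
  have := hm k
  rw [hj, Nat.succ_sub_one, pow_succ, ← hj]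
  field_simp

end Graphs

section Rings

open Finset

/-! ### Annihilators in finite local rings -/

theorem IsLocalRing.exists_ne_zero_forall_mul_eq_zero (A : Type*) [CommRing A] [IsLocalRing A]
    [Finite A] :
    ∃ r : A, r ≠ 0 ∧ (∀ z, ¬IsUnit z → r * z = 0) ∧ (¬IsField A → r * r = 0) := by
  classical
  have hex : ∃ n, maximalIdeal A ^ n = ⊥ := by
    have := IsArtinianRing.isNilpotent_jacobson_bot (R := A)
    rwa [jacobson_eq_maximalIdeal ⊥ bot_ne_top] at this
  -- Any nonzero element of the last nonzero power of the maximal ideal will do.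
  obtain ⟨k, hk⟩ : ∃ k, Nat.find hex = k + 1 := by
    refine Nat.exists_eq_succ_of_ne_zero fun h => ?_
    have := Nat.find_spec hex
    rw [h, pow_zero, Ideal.one_eq_top] at this
    exact bot_ne_top this.symm
  have hk1 : maximalIdeal A ^ (k + 1) = ⊥ := hk ▸ Nat.find_spec hex
  have hk0 : maximalIdeal A ^ k ≠ ⊥ := Nat.find_min hex (by omega)
  obtain ⟨r, hr, hr0⟩ := Submodule.exists_mem_ne_zero_of_ne_bot hk0
  have hkill : ∀ z, ¬IsUnit z → r * z = 0 := by
    intro z hz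
    have : r * z ∈ maximalIdeal A ^ (k + 1) := by
      rw [pow_succ]
      exact Ideal.mul_mem_mul hr ((mem_maximalIdeal z).mpr hz)
    rwa [hk1, Ideal.mem_bot] at this
  refine ⟨r, hr0, hkill, fun hA => hkill r ?_⟩
  rw [isField_iff_maximalIdeal_eq] at hA
  have hk' : k ≠ 0 := by
    rintro rfl
    rw [zero_add, pow_one] at hk1
    exact hA hk1
  exact (mem_maximalIdeal r).mp (Ideal.pow_le_self hk' hr)

theorem IsField.eq_zero_of_not_isUnit {B : Type*} [CommRing B] (hB : IsField B) {z : B}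
    (hz : ¬IsUnit z) : z = 0 := by
  by_contra h
  obtain ⟨w, hw⟩ := hB.mul_inv_cancel h
  exact hz (IsUnit.of_mul_eq_one w hw)

/-! ### The structure of the weakly zero-divisor graph -/

namespace LocalDecomposition

variable {R : Type*} [CommRing R] {ι : Type*} [Fintype ι] {A : ι → Type*} [∀ i, CommRing (A i)]

theorem finite_factor [Finite R] (D : LocalDecomposition R ι A) (i : ι) : Finite (A i) :=
  Finite.of_surjective (fun x => D.equiv x i)
    ((Function.surjective_eval i).comp D.equiv.surjective)

theorem mem_fieldIndices (D : LocalDecomposition R ι A) {k : ι} :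
    k ∈ D.fieldIndices ↔ IsField (A k) := by
  simp [fieldIndices]

theorem exists_not_isUnit (D : LocalDecomposition R ι A) {x : R}
    (hx : x ∈ nonzeroZeroDivisors R) : ∃ i, ¬IsUnit (D.equiv x i) := by
  obtain ⟨-, y, hy, hxy⟩ := hx
  by_contra! h
  refine hy (D.equiv.injective (funext fun i => ?_))
  have : D.equiv x i * D.equiv y i = 0 := by
    rw [← Pi.mul_apply, ← map_mul, hxy, map_zero, Pi.zero_apply]
  rw [map_zero, Pi.zero_apply]
  exact (h i).mul_right_eq_zero.mp this

theorem eq_of_mem_part (D : LocalDecomposition R ι A) {x : R} {k l : ι} (hk : x ∈ D.part k)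
    (hl : x ∈ D.part l) : k = l := by
  by_contra h
  have := D.isLocalRing k
  have hu := hl.2.2 k h
  rw [hk.2.1] at hu
  exact not_isUnit_zero hu

/-- The element of `R` supported at the coordinate `i`, with value `a` there. -/
noncomputable def single [DecidableEq ι] (D : LocalDecomposition R ι A) (i : ι) (a : A i) : R :=
  D.equiv.symm (Pi.single i a)

section single

variable [DecidableEq ι] (D : LocalDecomposition R ι A)

@[simp] theorem equiv_single (i : ι) (a : A i) : D.equiv (D.single i a) = Pi.single i a :=
  D.equiv.apply_symm_apply _

theorem single_ne_zero {i : ι} {a : A i} (ha : a ≠ 0) : D.single i a ≠ 0 := by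
  intro h
  have := congrArg (fun x => D.equiv x i) h
  simp [ha] at this

theorem single_mul_eq_zero {i : ι} {a : A i} {x : R} (h : a * D.equiv x i = 0) :
    D.single i a * x = 0 := by
  refine D.equiv.injective (funext fun j => ?_)
  rw [map_mul, map_zero, equiv_single, Pi.mul_apply, Pi.zero_apply]
  by_cases hj : j = i
  · subst hj
    simpa using h
  · simp [hj]

end single

/-- Adjacency fails exactly inside the sets `V_k`: the annihilator of an element of `V_k` is the
field factor `A k` itself, in which products of nonzero elements are nonzero. In all other cases
annihilating elements can be taken in two different factors, or equal to a common element of square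
zero in a factor that is not a field. -/
theorem weaklyZeroDivisorGraph_adj_iff [Finite R] (D : LocalDecomposition R ι A)
    (x y : nonzeroZeroDivisors R) :
    (weaklyZeroDivisorGraph R).Adj x y ↔
      x ≠ y ∧ ¬∃ k ∈ D.fieldIndices, (x : R) ∈ D.part k ∧ (y : R) ∈ D.part k := by
  classical
  have hloc := D.isLocalRing
  have hfin := D.finite_factor
  refine and_congr_right fun hxy => ⟨?_, fun h => ?_⟩
  · rintro ⟨r, s, hr, hs, hrx, hsy, hrs⟩ ⟨k, hk, hx, hy⟩
    have key : ∀ t z : R, t ≠ 0 → t * z = 0 → z ∈ D.part k → D.equiv t k ≠ 0 := by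
      intro t z ht htz hz h0
      refine ht (D.equiv.injective (funext fun i => ?_))
      rw [map_zero, Pi.zero_apply]
      by_cases hi : i = k
      · rw [hi, h0]
      · have : D.equiv t i * D.equiv z i = 0 := by
          rw [← Pi.mul_apply, ← map_mul, htz, map_zero, Pi.zero_apply]
        exact (hz.2.2 i hi).mul_left_eq_zero.mp this
    have hdom := (D.mem_fieldIndices.mp hk).isDomain
    have : D.equiv r k * D.equiv s k = 0 := by
      rw [← Pi.mul_apply, ← map_mul, hrs, map_zero, Pi.zero_apply]
    exact mul_ne_zero (key r x hr hrx hx) (key s y hs hsy hy) this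
  · choose a ha0 hkill hsq using fun i => IsLocalRing.exists_ne_zero_forall_mul_eq_zero (A i)
    obtain ⟨i, hi⟩ := D.exists_not_isUnit x.2
    obtain ⟨j, hj⟩ := D.exists_not_isUnit y.2
    have hann : ∀ i j, ¬IsUnit (D.equiv x i) → ¬IsUnit (D.equiv y j) →
        D.single i (a i) * D.single j (a j) = 0 →
        ∃ r s : R, r ≠ 0 ∧ s ≠ 0 ∧ r * x = 0 ∧ s * y = 0 ∧ r * s = 0 := fun i j hi hj h =>
      ⟨D.single i (a i), D.single j (a j), D.single_ne_zero (ha0 i), D.single_ne_zero (ha0 j),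
        D.single_mul_eq_zero (hkill i _ hi), D.single_mul_eq_zero (hkill j _ hj), h⟩
    have hoff : ∀ i j, i ≠ j → D.single i (a i) * D.single j (a j) = 0 := fun i j hij =>
      D.single_mul_eq_zero (by simp [hij])
    by_cases hall : ∀ i j, ¬IsUnit (D.equiv x i) → ¬IsUnit (D.equiv y j) → i = j
    · obtain rfl := hall i j hi hj
      by_cases hF : IsField (A i)
      · refine absurd ⟨i, D.mem_fieldIndices.mpr hF,
          ⟨x.2, hF.eq_zero_of_not_isUnit hi, fun l hl => ?_⟩,
          ⟨y.2, hF.eq_zero_of_not_isUnit hj, fun l hl => ?_⟩⟩ h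
        · by_contra hu
          exact hl (hall l i hu hj)
        · by_contra hu
          exact hl (hall i l hi hu).symm
      · exact hann i i hi hj (D.single_mul_eq_zero (by simpa using hsq i hF))
    · push Not at hall
      obtain ⟨i, j, hi, hj, hij⟩ := hall
      exact hann i j hi hj (hoff i j hij)

open scoped Classical in
/-- The class of a vertex in the complete multipartite structure: the index `k ∈ F` if the vertex
lies in `V_k`, and the vertex itself if it lies in `V_0`. -/
noncomputable def vertexClass (D : LocalDecomposition R ι A) (x : nonzeroZeroDivisors R) :
    D.fieldIndices ⊕ D.rest :=
  if h : ∃ k : D.fieldIndices, (x : R) ∈ D.part k then Sum.inl h.choose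
  else Sum.inr ⟨x, x.2, by
    simp only [Set.mem_iUnion]
    rintro ⟨k, hk, hx⟩
    exact h ⟨⟨k, hk⟩, hx⟩⟩

theorem vertexClass_eq_inl_iff (D : LocalDecomposition R ι A) {x : nonzeroZeroDivisors R}
    {k : D.fieldIndices} : D.vertexClass x = Sum.inl k ↔ (x : R) ∈ D.part k := by
  unfold vertexClass
  split_ifs with h
  · rw [Sum.inl.injEq]
    exact ⟨fun hk => hk ▸ h.choose_spec,
      fun hk => Subtype.ext (D.eq_of_mem_part h.choose_spec hk)⟩
  · exact ⟨fun hk => absurd hk (by simp), fun hk => absurd ⟨k, hk⟩ h⟩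

theorem vertexClass_eq_inr_iff (D : LocalDecomposition R ι A) {x : nonzeroZeroDivisors R}
    {v : D.rest} : D.vertexClass x = Sum.inr v ↔ (x : R) = v := by
  unfold vertexClass
  split_ifs with h
  · refine ⟨fun hk => absurd hk (by simp), fun hx => ?_⟩
    obtain ⟨k, hk⟩ := h
    exact absurd (Set.mem_biUnion k.2 (hx ▸ hk)) v.2.2
  · rw [Sum.inr.injEq, Subtype.ext_iff]

theorem weaklyZeroDivisorGraph_adj_iff_vertexClass_ne [Finite R] (D : LocalDecomposition R ι A)
    (x y : nonzeroZeroDivisors R) :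
    (weaklyZeroDivisorGraph R).Adj x y ↔ D.vertexClass x ≠ D.vertexClass y := by
  rw [D.weaklyZeroDivisorGraph_adj_iff, ← not_iff_not, not_not, not_and, not_not]
  constructor
  · intro h
    by_cases hxy : x = y
    · rw [hxy]
    · obtain ⟨k, hk, hx, hy⟩ := h hxy
      rw [(D.vertexClass_eq_inl_iff (k := ⟨k, hk⟩)).mpr hx,
        (D.vertexClass_eq_inl_iff (k := ⟨k, hk⟩)).mpr hy]
  · intro h hxy
    rcases hc : D.vertexClass y with k | v
    · exact ⟨k, k.2, D.vertexClass_eq_inl_iff.mp (h.trans hc), D.vertexClass_eq_inl_iff.mp hc⟩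
    · exact absurd (Subtype.ext ((D.vertexClass_eq_inr_iff.mp (h.trans hc)).trans
        (D.vertexClass_eq_inr_iff.mp hc).symm)) hxy

/-- A field has no nonzero zero-divisors, so a second factor is present as soon as there is a vertex
and one of the factors is a field. -/
theorem exists_ne_of_isField (D : LocalDecomposition R ι A) {k : ι} (hk : IsField (A k))
    (hR : (nonzeroZeroDivisors R).Nonempty) : ∃ l, l ≠ k := by
  obtain ⟨x, hx⟩ := hR
  by_contra! h
  obtain ⟨i, hi⟩ := D.exists_not_isUnit hx
  refine hx.1 (D.equiv.injective (funext fun j => ?_))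
  obtain rfl := h i
  obtain rfl := h j
  rw [hk.eq_zero_of_not_isUnit hi, map_zero, Pi.zero_apply]

theorem part_nonempty (D : LocalDecomposition R ι A) {k : ι} (hk : IsField (A k))
    (hR : (nonzeroZeroDivisors R).Nonempty) : (D.part k).Nonempty := by
  classical
  obtain ⟨l, hl⟩ := D.exists_ne_of_isField hk hR
  have hloc := D.isLocalRing
  let x : R := D.equiv.symm fun i => if i = k then 0 else 1
  have hx : ∀ i, D.equiv x i = if i = k then 0 else 1 := fun i => by simp [x]
  refine ⟨x, ⟨fun h => ?_, D.single k 1, D.single_ne_zero one_ne_zero, ?_⟩, by simp [hx],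
    fun i hi => by simp [hx, hi]⟩
  · have := hx l
    rw [h, if_neg hl, map_zero, Pi.zero_apply] at this
    exact zero_ne_one this
  · rw [mul_comm]
    exact D.single_mul_eq_zero (by simp [hx])

/-- An element supported at the coordinate `k` is a vertex outside `V_k`. -/
theorem part_ne_nonzeroZeroDivisors (D : LocalDecomposition R ι A) {k : ι} (hk : IsField (A k))
    (hR : (nonzeroZeroDivisors R).Nonempty) : D.part k ≠ nonzeroZeroDivisors R := by
  classical
  obtain ⟨l, hl⟩ := D.exists_ne_of_isField hk hR
  have hloc := D.isLocalRing
  intro h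
  have hmem : D.single k 1 ∈ nonzeroZeroDivisors R :=
    ⟨D.single_ne_zero one_ne_zero, D.single l 1, D.single_ne_zero one_ne_zero,
      D.single_mul_eq_zero (by simp [hl.symm])⟩
  rw [← h] at hmem
  have := hmem.2.1
  simp at this

theorem vertexClass_surjective (D : LocalDecomposition R ι A)
    (hR : (nonzeroZeroDivisors R).Nonempty) : Function.Surjective D.vertexClass := by
  rintro (k | v)
  · obtain ⟨x, hx⟩ := D.part_nonempty (D.mem_fieldIndices.mp k.2) hR
    exact ⟨⟨x, hx.1⟩, D.vertexClass_eq_inl_iff.mpr hx⟩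
  · exact ⟨⟨v, v.2.1⟩, D.vertexClass_eq_inr_iff.mpr rfl⟩

end LocalDecomposition

namespace LocalDecomposition

variable {R : Type*} [CommRing R] {ι : Type*} [Fintype ι] {A : ι → Type*} [∀ i, CommRing (A i)]

open scoped Classical in
theorem card_vertexClass_eq_inl [Fintype (nonzeroZeroDivisors R)] (D : LocalDecomposition R ι A)
    (k : D.fieldIndices) :
    #{x : nonzeroZeroDivisors R | D.vertexClass x = Sum.inl k} = (D.part k).ncard := by
  rw [← card_image_of_injective _ Subtype.val_injective, ← Set.ncard_coe_finset]
  congr 1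
  ext x
  simp only [coe_image, Set.mem_image, mem_coe, mem_filter, mem_univ, true_and,
    D.vertexClass_eq_inl_iff]
  exact ⟨by rintro ⟨y, hy, rfl⟩; exact hy, fun hx => ⟨⟨x, hx.1⟩, hx, rfl⟩⟩

open scoped Classical in
theorem card_vertexClass_eq_inr [Fintype (nonzeroZeroDivisors R)] (D : LocalDecomposition R ι A)
    (v : D.rest) : #{x : nonzeroZeroDivisors R | D.vertexClass x = Sum.inr v} = 1 := by
  refine card_eq_one.mpr ⟨⟨v, v.2.1⟩, ?_⟩
  ext x
  simp [D.vertexClass_eq_inr_iff, Subtype.ext_iff]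

end LocalDecomposition

theorem SimpleGraph.spanningTreeCount_of_subsingleton {V : Type*} [Nonempty V] [Subsingleton V]
    (G : SimpleGraph V) : G.spanningTreeCount = 1 := by
  refine Set.ncard_eq_one.mpr ⟨⊥, Set.ext fun T => ?_⟩
  exact ⟨fun _ => Subsingleton.elim _ _, fun _ =>
    ⟨le_of_eq (Subsingleton.elim _ _), SimpleGraph.IsTree.of_subsingleton⟩⟩

end Rings

open Finset in
theorem corollary4p7 {R : Type*} [CommRing R] [Finite R]
    {ι : Type*} [Fintype ι] {A : ι → Type*} [∀ i, CommRing (A i)]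
    (D : LocalDecomposition R ι A) (N : ℕ) (hN : N = (nonzeroZeroDivisors R).ncard) :
    (N = 1 →
      Nonempty (weaklyZeroDivisorGraph R ≃g (⊥ : SimpleGraph (Fin 1))) ∧
        (weaklyZeroDivisorGraph R).spanningTreeCount = 1) ∧
    (2 ≤ N →
      ((weaklyZeroDivisorGraph R).spanningTreeCount : ℚ) =
        (N : ℚ) ^ ((D.fieldIndices.card : ℤ) + (D.rest.ncard : ℤ) - 2) *
          ∏ k ∈ D.fieldIndices,
            ((N : ℚ) - ((D.part k).ncard : ℚ)) ^ (((D.part k).ncard : ℤ) - 1)) := by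
  classical
  have := Fintype.ofFinite (nonzeroZeroDivisors R)
  have := Fintype.ofFinite D.rest
  have hcard : Fintype.card (nonzeroZeroDivisors R) = N := by
    rw [hN, ← Nat.card_coe_set_eq, Nat.card_eq_fintype_card]
  refine ⟨fun h1 => ?_, fun h2 => ?_⟩
  · obtain ⟨e⟩ : Nonempty (nonzeroZeroDivisors R ≃ Fin 1) :=
      ⟨Fintype.equivFinOfCardEq (hcard.trans h1)⟩
    have : Subsingleton (nonzeroZeroDivisors R) := e.subsingleton
    have : Nonempty (nonzeroZeroDivisors R) := ⟨e.symm 0⟩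
    refine ⟨⟨⟨e, fun {x y} => ?_⟩⟩, SimpleGraph.spanningTreeCount_of_subsingleton _⟩
    rw [Subsingleton.elim x y]
    simp
  · have : Nonempty (nonzeroZeroDivisors R) := Fintype.card_pos_iff.mp (by omega)
    have hR : (nonzeroZeroDivisors R).Nonempty := Set.nonempty_coe_sort.mp this
    have hclass : ∀ k, #{x | D.vertexClass x = k} ≠ Fintype.card (nonzeroZeroDivisors R) := by
      rintro (k | v)
      · rw [D.card_vertexClass_eq_inl, hcard, hN]
        exact (Set.ncard_lt_ncard (LE.le.ssubset_of_ne (fun x hx => hx.1)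
          (D.part_ne_nonzeroZeroDivisors (D.mem_fieldIndices.mp k.2) hR))
          (Set.toFinite _)).ne
      · rw [D.card_vertexClass_eq_inr]
        omega
    have key := card_sq_mul_spanningTreeCount_of_adj_iff (weaklyZeroDivisorGraph R) D.vertexClass
      (D.vertexClass_surjective hR) D.weaklyZeroDivisorGraph_adj_iff_vertexClass_ne hclass
    have hK : Fintype.card (D.fieldIndices ⊕ D.rest) = #D.fieldIndices + D.rest.ncard := by
      rw [Fintype.card_sum, Fintype.card_coe, ← Nat.card_coe_set_eq, Nat.card_eq_fintype_card]
    -- Truncated subtraction in the exponents is harmless because every `V_k` is nonempty.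
    have hexp : ∀ k ∈ D.fieldIndices,
        ((N : ℚ) - (D.part k).ncard) ^ (((D.part k).ncard : ℤ) - 1) =
          ((N : ℚ) - (D.part k).ncard) ^ ((D.part k).ncard - 1) := by
      intro k hk
      have hpos : 1 ≤ (D.part k).ncard :=
        (D.part_nonempty (D.mem_fieldIndices.mp hk) hR).ncard_pos (Set.toFinite _)
      rw [← zpow_natCast, Nat.cast_sub hpos, Nat.cast_one]
    have hN0 : (N : ℚ) ≠ 0 := by
      have : N ≠ 0 := by omega
      exact_mod_cast this
    simp only [Fintype.prod_sum_type, D.card_vertexClass_eq_inl, D.card_vertexClass_eq_inr,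
      Nat.sub_self, pow_zero, prod_const_one, mul_one, hcard, hK] at key
    rw [prod_coe_sort D.fieldIndices
      fun k => ((N : ℚ) - (D.part k).ncard) ^ ((D.part k).ncard - 1)] at key
    rw [prod_congr rfl hexp, zpow_sub₀ hN0, div_mul_eq_mul_div, eq_div_iff (by positivity),
      mul_comm]
    exact_mod_cast key
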